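/- Conventions. Let $R$ be a commutative Noetherian ring and $M \neq 0$ a finitely generated $R$-module; $\dim_R N$ denotes the Krull dimension of $\mathrm{Supp}_R N$, with $\dim_R(0) = -\infty$. Let $$\mathcal{S}(M) = \{\dim_R N \mid N \text{ is a nonzero } R\text{-submodule of } M\} = \{d_1 < d_2 < \cdots < d_\ell\},$$ which is a finite set. The dimension filtration of $M$ is the chain $D_0 = (0) \subsetneq D_1 \subsetneq \cdots \subsetneq D_\ell = M$, where for $1 \le i \le \ell$ the submodule $D_i$ is the largest submodule of $M$ with $\dim_R D_i \le d_i$. The module $M$ is called sequentially Cohen-Macaulay if $D_i/D_{i-1}$ is a Cohen-Macaulay $R$-module for every $1 \le i \le \ell$. Here a finitely generated $R$-module $C$ is Cohen-Macaulay if $\mathrm{depth}_{R_P} C_P = \dim_{R_P} C_P$ for every maximal ideal $P \in \mathrm{Supp}_R C$. Statement. Let $R$ be a finitely generated commutative algebra over a field and $M \neq (0)$ a finitely generated $R$-module. Then the following conditions are equivalent. 1. $M$ is a sequentially Cohen-Macaulay $R$-module. 2. $M_P$ is a sequentially Cohen-Macaulay $R_P$-module for every $P \in \mathrm{Supp}_R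 M$. -/

import Mathlib

namespace SeqCM

/-- The depth of a module `M` over a local ring `R`: the supremum of the lengths of the
`M`-regular sequences consisting of elements of the maximal ideal of `R`. -/
noncomputable def depth (R : Type*) [CommRing R] [IsLocalRing R]
    (M : Type*) [AddCommGroup M] [Module R M] : ℕ∞ :=
  ⨆ rs ∈ {rs : List R | (∀ r ∈ rs, r ∈ IsLocalRing.maximalIdeal R) ∧
    RingTheory.Sequence.IsRegular M rs}, (rs.length : ℕ∞)

/-- A (finitely generated) module `M` over a (Noetherian) ring `R` is Cohen-Macaulay if
`depth M_P = dim M_P` over the local ring `R_P` for every maximal ideal `P` in the support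
of `M`. The dimension is the Krull dimension of the support. -/
def IsCohenMacaulay (R : Type*) [CommRing R] (M : Type*) [AddCommGroup M] [Module R M] : Prop :=
  ∀ P : PrimeSpectrum R, P.asIdeal.IsMaximal → P ∈ Module.support R M →
    (depth (Localization.AtPrime P.asIdeal) (LocalizedModule P.asIdeal.primeCompl M) :
        WithBot ℕ∞) =
      Module.supportDim (Localization.AtPrime P.asIdeal)
        (LocalizedModule P.asIdeal.primeCompl M)

/-- The set `𝓢(M)` of the dimensions of the nonzero submodules of `M`. -/
def dimSet (R : Type*) [CommRing R] (M : Type*) [AddCommGroup M] [Module R M] :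
    Set (WithBot ℕ∞) :=
  {e | ∃ N : Submodule R M, N ≠ ⊥ ∧ Module.supportDim R N = e}

/-- `D 0, …, D ℓ` is the dimension filtration of `M`: writing `𝓢(M) = {d₁ < ⋯ < d_ℓ}`,
one has `D 0 = 0` and `D i` is the largest submodule of `M` of dimension at most `dᵢ` for
`1 ≤ i ≤ ℓ` (here `dᵢ` is `d (i - 1)`, as `Fin ℓ` starts at zero). -/
def IsDimensionFiltration (R : Type*) [CommRing R] (M : Type*) [AddCommGroup M] [Module R M]
    (ℓ : ℕ) (D : Fin (ℓ + 1) → Submodule R M) : Prop :=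
  D 0 = ⊥ ∧ ∃ d : Fin ℓ → WithBot ℕ∞, StrictMono d ∧ Set.range d = dimSet R M ∧
    ∀ i : Fin ℓ, IsGreatest {N : Submodule R M | Module.supportDim R N ≤ d i} (D i.succ)

/-- `M` is sequentially Cohen-Macaulay if the successive quotients `D i / D (i - 1)`,
`1 ≤ i ≤ ℓ`, of its dimension filtration are Cohen-Macaulay. The dimension filtration is unique
and it exists when `M` is finitely generated over a Noetherian ring. -/
def IsSequentiallyCohenMacaulay (R : Type*) [CommRing R]
    (M : Type*) [AddCommGroup M] [Module R M] : Prop :=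
  ∃ (ℓ : ℕ) (D : Fin (ℓ + 1) → Submodule R M), IsDimensionFiltration R M ℓ D ∧
    ∀ i : Fin ℓ, IsCohenMacaulay R (D i.succ ⧸ (D i.castSucc).submoduleOf (D i.succ))

end SeqCM

/-
Write `D_{<n}` for the largest submodule of `M` of dimension less than `n`. The module `M` is
sequentially Cohen-Macaulay if and only if every `D_{<n+1} / D_{<n}` is zero or Cohen-Macaulay.
Over a finitely generated algebra over a field, `dim R/p = ht P/p + dim R/P` for all primes
`p ≤ P`; hence localizing `M` at `P` turns `D_{<n+dim R/P}` into `D_{<n}` of `M_P`. As the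
Cohen-Macaulay property passes to localizations, so does the sequential one. Conversely, at a
maximal ideal the index shift `dim R/P` is zero, and the Cohen-Macaulay property is tested there.
-/

namespace SeqCM

section DimensionFormula

theorem height_Ici_eq_coheight_Iic {α : Type*} [Preorder α] {x y : α} (h : x ≤ y) :
    Order.height (⟨y, h⟩ : Set.Ici x) = Order.coheight (⟨x, h⟩ : Set.Iic y) := by
  rw [← WithBot.coe_inj, Order.height_eq_krullDim_Iic, Order.coheight_eq_krullDim_Ici]
  exact Order.krullDim_eq_of_orderIso
    { toFun := fun z => ⟨⟨z.1.1, z.2⟩, z.1.2⟩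
      invFun := fun z => ⟨⟨z.1.1, z.2⟩, z.1.2⟩
      left_inv := fun _ => rfl
      right_inv := fun _ => rfl
      map_rel_iff' := Iff.rfl }

theorem coheight_Ici {α : Type*} [Preorder α] {x y : α} (h : x ≤ y) :
    Order.coheight (⟨y, h⟩ : Set.Ici x) = Order.coheight y := by
  rw [← WithBot.coe_inj, Order.coheight_eq_krullDim_Ici, Order.coheight_eq_krullDim_Ici]
  exact Order.krullDim_eq_of_orderIso
    { toFun := fun z => ⟨z.1.1, z.2⟩
      invFun := fun z => ⟨⟨z.1, h.trans z.2⟩, z.2⟩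
      left_inv := fun _ => rfl
      right_inv := fun _ => rfl
      map_rel_iff' := Iff.rfl }

theorem height_Ici_add_coheight_le {α : Type*} [Preorder α] {x y : α} (h : x ≤ y) :
    Order.height (⟨y, h⟩ : Set.Ici x) + Order.coheight y ≤ Order.coheight x := by
  have : Nonempty (Set.Ici x) := ⟨⟨y, h⟩⟩
  rw [← coheight_Ici h, ← WithBot.coe_le_coe, Order.coheight_eq_krullDim_Ici x,
    Order.krullDim_eq_iSup_height_add_coheight_of_nonempty, WithBot.coe_le_coe]
  exact le_iSup (fun a : Set.Ici x => Order.height a + Order.coheight a) ⟨y, h⟩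

/-- The dimension formula `dim R/p = ht P/p + dim R/P` for all primes `p ≤ P`, read off the order
on the spectrum: `dim R/p` is the coheight of `p`, and `ht P/p` is the height of `P` among the
primes above `p`. -/
def HasDimensionFormula (R : Type*) [CommRing R] : Prop :=
  ∀ ⦃p P : PrimeSpectrum R⦄ (h : p ≤ P),
    Order.coheight p = Order.height (⟨P, h⟩ : Set.Ici p) + Order.coheight P

theorem HasDimensionFormula.coheight_comap {R : Type*} [CommRing R] (hR : HasDimensionFormula R)
    (P : PrimeSpectrum R) (S : Type*) [CommRing S] [Algebra R S]
    [IsLocalization.AtPrime S P.asIdeal] (q : PrimeSpectrum S) :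
    Order.coheight (PrimeSpectrum.comap (algebraMap R S) q) =
      Order.coheight q + Order.coheight P := by
  let e := IsLocalization.AtPrime.primeSpectrumOrderIso S P.asIdeal
  have hle : PrimeSpectrum.comap (algebraMap R S) q ≤ P := (e q).2
  rw [hR hle, height_Ici_eq_coheight_Iic, ← Order.coheight_orderIso e q]
  rfl

/-- The spectrum of `R ⧸ p` is the set of primes above `p`. -/
noncomputable def quotientOrderIsoIci {R : Type*} [CommRing R] (p : PrimeSpectrum R) :
    PrimeSpectrum (R ⧸ p.asIdeal) ≃o Set.Ici p :=
  p.asIdeal.primeSpectrumQuotientOrderIsoZeroLocus.trans (OrderIso.setCongr _ _ rfl)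

theorem ringKrullDim_quotient_eq_coheight {R : Type*} [CommRing R] (p : PrimeSpectrum R) :
    ringKrullDim (R ⧸ p.asIdeal) = Order.coheight p := by
  rw [Order.coheight_eq_krullDim_Ici]
  exact Order.krullDim_eq_of_orderIso (quotientOrderIsoIci p)

theorem height_mvPolynomial_eq_of_isMaximal {k : Type*} [Field k] {n : ℕ}
    (m : Ideal (MvPolynomial (Fin n) k)) [m.IsMaximal] : m.height = n := by
  induction n with
  | zero =>
    have hf : IsField (MvPolynomial (Fin 0) k) :=
      (MvPolynomial.isEmptyAlgEquiv k (Fin 0)).toMulEquiv.isField (Field.toIsField k)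
    let := hf.toField
    rw [(Ideal.eq_bot_or_top m).resolve_right (Ideal.IsMaximal.ne_top ‹_›), Ideal.height_bot,
      Nat.cast_zero]
  | succ n ih =>
    let e := (MvPolynomial.finSuccEquiv k n).toRingEquiv
    have : (m.map e).IsMaximal := Ideal.map_isMaximal_of_equiv e
    have : ((m.map e).comap Polynomial.C).IsMaximal :=
      Polynomial.isMaximal_comap_C_of_isJacobsonRing _
    have : (m.map e).LiesOver ((m.map e).comap Polynomial.C) := ⟨rfl⟩
    rw [← RingEquiv.height_map e,
      Polynomial.height_eq_height_add_one ((m.map e).comap Polynomial.C) (m.map e), ih,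
      Nat.cast_succ]

theorem strictMono_comap_of_isIntegral {R S : Type*} [CommRing R] [CommRing S]
    [Algebra R S] [Algebra.IsIntegral R S] :
    StrictMono (PrimeSpectrum.comap (algebraMap R S)) := by
  intro p q h
  obtain ⟨hle, x, hxq, hxp⟩ := SetLike.lt_iff_le_and_exists.mp
    (show p.asIdeal < q.asIdeal from h)
  exact Ideal.comap_lt_comap_of_integral_mem_sdiff hle ⟨hxq, hxp⟩
    (Algebra.IsIntegral.isIntegral x)

theorem height_under_of_isIntegral {R S : Type*} [CommRing R] [CommRing S] [Algebra R S]
    [IsNoetherianRing R] [IsNoetherianRing S] [Algebra.IsIntegral R S] [Algebra.HasGoingDown R S]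
    (P : Ideal S) [P.IsPrime] : (P.under R).height = P.height := by
  refine le_antisymm ?_ ?_
  · rw [Ideal.height_eq_height_add_of_liesOver_of_hasGoingDown (P.under R) P]
    exact le_self_add
  · have h := Order.height_le_height_apply_of_strictMono _
      (strictMono_comap_of_isIntegral (R := R)) (⟨P, inferInstance⟩ : PrimeSpectrum S)
    rwa [← PrimeSpectrum.height_eq_orderHeight, ← PrimeSpectrum.height_eq_orderHeight] at h

theorem height_eq_ringKrullDim_of_isMaximal (k : Type*) [Field k] {A : Type*} [CommRing A]
    [IsDomain A] [Algebra k A] [Algebra.FiniteType k A] (m : Ideal A) [m.IsMaximal] :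
    (m.height : WithBot ℕ∞) = ringKrullDim A := by
  obtain ⟨n, g, hg, hint⟩ := exists_integral_inj_algHom_of_fg k A
  have : IsNoetherianRing A := Algebra.FiniteType.isNoetherianRing k A
  let := g.toRingHom.toAlgebra
  have : Algebra.IsIntegral (MvPolynomial (Fin n) k) A := ⟨hint⟩
  have : FaithfulSMul (MvPolynomial (Fin n) k) A :=
    (faithfulSMul_iff_algebraMap_injective _ _).mpr hg
  have height_eq (m' : Ideal A) (_ : m'.IsMaximal) : m'.height = n := by
    have : (m'.under (MvPolynomial (Fin n) k)).IsMaximal :=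
      Ideal.isMaximal_comap_of_isIntegral_of_isMaximal m'
    rw [← height_under_of_isIntegral (R := MvPolynomial (Fin n) k) m',
      height_mvPolynomial_eq_of_isMaximal]
  rw [← Ideal.sup_isMaximal_height_eq_ringKrullDim, WithBot.coe_inj]
  exact le_antisymm (le_iSup₂_of_le m ‹_› le_rfl)
    (iSup₂_le fun m' hm' => (height_eq m' hm').trans_le (height_eq m ‹_›).ge)

theorem exists_isMaximal_forall_minimalPrimes_eq {A : Type*} [CommRing A]
    [IsNoetherianRing A] [IsJacobsonRing A] {I P : Ideal A} (hP : P ∈ I.minimalPrimes) :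
    ∃ m : Ideal A, m.IsMaximal ∧ P ≤ m ∧ ∀ q ∈ I.minimalPrimes, q ≤ m → q = P := by
  have hPp : P.IsPrime := hP.isPrime
  have hfin : (I.minimalPrimes \ {P}).Finite :=
    (Ideal.finite_minimalPrimes_of_isNoetherianRing A I).sdiff
  have hnot : ¬ sInf (I.minimalPrimes \ {P}) ≤ P := by
    rw [← hfin.coe_toFinset, ← Finset.inf_id_eq_sInf, Ideal.IsPrime.inf_le' hPp]
    rintro ⟨q, hq, hqP⟩
    obtain ⟨hqI, hne⟩ := hfin.mem_toFinset.mp hq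
    exact hne (le_antisymm hqP (hP.2 hqI.1 hqP))
  obtain ⟨s, hs, hsP⟩ := SetLike.not_le_iff_exists.mp hnot
  rw [← isJacobsonRing_iff_prime_eq.mp ‹_› P hPp, Ideal.jacobson, Submodule.mem_sInf] at hsP
  push Not at hsP
  obtain ⟨m, ⟨hPm, hm⟩, hsm⟩ := hsP
  refine ⟨m, hm, hPm, fun q hq hqm => ?_⟩
  by_contra hne
  exact hsm (hqm (Submodule.mem_sInf.mp hs q ⟨hq, hne⟩))

theorem height_map_quotient_le_coheight {A : Type*} [CommRing A] {I m : Ideal A}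
    [m.IsPrime] (hI : I ≤ m) {P : PrimeSpectrum A}
    (h : ∀ q ∈ I.minimalPrimes, q ≤ m → q = P.asIdeal) :
    (m.map (Ideal.Quotient.mk I)).height ≤ Order.coheight P := by
  let m' : PrimeSpectrum (A ⧸ I) :=
    ⟨m.map (Ideal.Quotient.mk I), Ideal.isPrime_map_quotientMk_of_isPrime hI⟩
  have comap_mem (y : Set.Iic m') :
      PrimeSpectrum.comap (Ideal.Quotient.mk I) y.1 ∈ Set.Ici P := by
    have hIy : I ≤ y.1.asIdeal.comap (Ideal.Quotient.mk I) := by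
      rw [← Ideal.map_le_iff_le_comap, Ideal.map_quotient_self]
      exact bot_le
    have hym : y.1.asIdeal.comap (Ideal.Quotient.mk I) ≤ m := by
      refine (Ideal.comap_mono (show y.1.asIdeal ≤ m'.asIdeal from y.2)).trans ?_
      rw [Ideal.comap_map_of_surjective _ Ideal.Quotient.mk_surjective,
        ← RingHom.ker_eq_comap_bot, Ideal.mk_ker, sup_eq_left.mpr hI]
    obtain ⟨q, hq, hqy⟩ := Ideal.exists_minimalPrimes_le hIy
    exact (h q hq (hqy.trans hym)).symm.trans_le hqy
  have hs : StrictMono (PrimeSpectrum.comap (Ideal.Quotient.mk I)) :=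
    RingHom.strictMono_comap_of_surjective Ideal.Quotient.mk_surjective
  rw [← WithBot.coe_le_coe, PrimeSpectrum.height_eq_orderHeight m',
    Order.height_eq_krullDim_Iic, Order.coheight_eq_krullDim_Ici]
  exact Order.krullDim_le_of_strictMono (fun y => ⟨_, comap_mem y⟩) fun _ _ hab => hs hab

/- Let `I` be generated by `ht P` elements with `P` a minimal prime of `I`. Choosing a maximal ideal
`m` above `P` that contains no other minimal prime of `I`, Krull's height theorem gives
`dim A = ht m ≤ ht P + ht (m/I) ≤ ht P + dim A/P`. -/
theorem ringKrullDim_le_height_add_coheight (k : Type*) [Field k] {A : Type*} [CommRing A]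
    [IsDomain A] [Algebra k A] [Algebra.FiniteType k A] (P : PrimeSpectrum A) :
    ringKrullDim A ≤ (Order.height P + Order.coheight P : ℕ∞) := by
  have : IsNoetherianRing A := Algebra.FiniteType.isNoetherianRing k A
  have : IsJacobsonRing A := isJacobsonRing_of_finiteType (A := k)
  obtain ⟨s, hs, hcard⟩ := P.asIdeal.exists_finset_card_eq_height_of_isNoetherianRing
  obtain ⟨m, _, hPm, huniq⟩ := exists_isMaximal_forall_minimalPrimes_eq hs
  have hIm : Ideal.span (s : Set A) ≤ m := hs.1.2.trans hPm
  have hrank : (Ideal.span (s : Set A)).spanFinrank ≤ s.card :=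
    (Submodule.spanFinrank_span_le_ncard_of_finite s.finite_toSet).trans_eq
      (Set.ncard_coe_finset s)
  rw [← height_eq_ringKrullDim_of_isMaximal k m, WithBot.coe_le_coe,
    ← PrimeSpectrum.height_eq_orderHeight, ← hcard, add_comm]
  calc m.height
    _ ≤ (m.map (Ideal.Quotient.mk (Ideal.span (s : Set A)))).height +
          (Ideal.span (s : Set A)).spanFinrank := Ideal.height_le_height_add_spanFinrank_of_le hIm
    _ ≤ Order.coheight P + s.card :=
        add_le_add (height_map_quotient_le_coheight hIm huniq) (mod_cast hrank)

theorem hasDimensionFormula_of_finiteType (k : Type*) [Field k] (R : Type*) [CommRing R]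
    [Algebra k R] [Algebra.FiniteType k R] : HasDimensionFormula R := by
  intro p P h
  refine le_antisymm ?_ (height_Ici_add_coheight_le h)
  have hdim := ringKrullDim_le_height_add_coheight k ((quotientOrderIsoIci p).symm ⟨P, h⟩)
  rwa [ringKrullDim_quotient_eq_coheight, Order.height_orderIso, Order.coheight_orderIso,
    coheight_Ici, WithBot.coe_le_coe] at hdim

theorem ringKrullDim_ne_top_of_finiteType (k : Type*) [Field k] (R : Type*) [CommRing R]
    [Algebra k R] [Algebra.FiniteType k R] : ringKrullDim R ≠ ⊤ := by
  obtain ⟨n, f, hf⟩ := Algebra.FiniteType.iff_quotient_mvPolynomial''.mp ‹Algebra.FiniteType k R›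
  have hle := ringKrullDim_le_of_surjective f.toRingHom hf
  rw [MvPolynomial.ringKrullDim_of_isNoetherianRing, ringKrullDim_eq_zero_of_field, zero_add] at hle
  exact (hle.trans_lt (WithBot.coe_lt_coe.mpr (ENat.natCast_lt_top _))).ne

end DimensionFormula

section SupportedIn

variable {R : Type*} [CommRing R] {M : Type*} [AddCommGroup M] [Module R M]

variable (R M) in
/-- The largest submodule of `M` whose support is contained in the set of primes `Z`
(the sections of `M` with support in `Z`). -/
def supportedIn (Z : Set (PrimeSpectrum R)) : Submodule R M where
  carrier := {x | PrimeSpectrum.zeroLocus ((R ∙ x).annihilator : Set R) ⊆ Z}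
  add_mem' {x y} hx hy := by
    have hle : (R ∙ x).annihilator ⊓ (R ∙ y).annihilator ≤ (R ∙ (x + y)).annihilator := by
      rintro r ⟨hrx, hry⟩
      rw [SetLike.mem_coe, Submodule.mem_annihilator_span_singleton] at hrx hry
      rw [Submodule.mem_annihilator_span_singleton, smul_add, hrx, hry, add_zero]
    refine (PrimeSpectrum.zeroLocus_anti_mono hle).trans ?_
    rw [PrimeSpectrum.zeroLocus_inf]
    exact Set.union_subset hx hy
  zero_mem' := by
    rw [Set.mem_ofPred_eq, Submodule.span_zero_singleton, Submodule.annihilator_bot,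
      Submodule.top_coe, PrimeSpectrum.zeroLocus_univ]
    exact Set.empty_subset Z
  smul_mem' r x hx :=
    (PrimeSpectrum.zeroLocus_anti_mono
      (Submodule.annihilator_mono (Submodule.span_singleton_smul_le R r x))).trans hx

theorem le_supportedIn_iff {N : Submodule R M} {Z : Set (PrimeSpectrum R)} :
    N ≤ supportedIn R M Z ↔ Module.support R N ⊆ Z := by
  have annihilator_eq (x : N) : (R ∙ x).annihilator = (R ∙ (x : M)).annihilator := by
    ext r
    rw [Submodule.mem_annihilator_span_singleton, Submodule.mem_annihilator_span_singleton,
      ← N.coe_smul, Submodule.coe_eq_zero]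
  constructor
  · intro h p hp
    obtain ⟨x, hx⟩ := Module.mem_support_iff_exists_annihilator.mp hp
    exact h x.2 (annihilator_eq x ▸ hx)
  · intro h x hx p hp
    exact h (Module.mem_support_iff_exists_annihilator.mpr ⟨⟨x, hx⟩, annihilator_eq ⟨x, hx⟩ ▸ hp⟩)

variable (S : Submonoid R) {M' : Type*} [AddCommGroup M'] [Module R M'] (f : M →ₗ[R] M')
  [IsLocalizedModule S f]

theorem exists_annihilator_le_annihilator_smul [IsNoetherianRing R] (m : M) :
    ∃ u : S, (R ∙ f m).annihilator ≤ (R ∙ (u • m)).annihilator := by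
  let K : Ideal R := LinearMap.ker (f ∘ₗ LinearMap.toSpanSingleton R M m)
  obtain ⟨u, hu⟩ := Module.Finite.exists_smul_of_comp_eq_of_isLocalizedModule S f
    (LinearMap.toSpanSingleton R M m ∘ₗ K.subtype) 0 (by
      rw [LinearMap.comp_zero]
      exact LinearMap.ext fun x => x.2)
  refine ⟨u, fun r hr => ?_⟩
  rw [Submodule.mem_annihilator_span_singleton] at hr ⊢
  have hsmul : u • r • m = u • (0 : M) :=
    LinearMap.congr_fun hu (⟨r, (map_smul f r m).trans hr⟩ : K)
  rw [smul_comm, hsmul, smul_zero]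

theorem disjoint_of_mem_minimalPrimes_annihilator {m : M} {p : Ideal R}
    (hp : p ∈ (R ∙ f m).annihilator.minimalPrimes) : Disjoint (S : Set R) p := by
  rw [Set.disjoint_left]
  intro s hs
  have hreg : IsSMulRegular M' s := IsLocalizedModule.smul_injective f (⟨s, hs⟩ : S)
  exact (hreg.submodule (R ∙ f m) s).notMem_of_mem_minimalPrimes hp

variable {R' : Type*} [CommRing R'] [Algebra R R'] [IsLocalization S R'] [Module R' M']
  [IsScalarTower R R' M']

include S in
theorem annihilator_span_singleton_le_iff_of_isLocalization {y : M'} {I : Ideal R'} :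
    (R' ∙ y).annihilator ≤ I ↔ (R ∙ y).annihilator ≤ I.under R := by
  have hunder : (R' ∙ y).annihilator.under R = (R ∙ y).annihilator := by
    ext r
    rw [Ideal.under_def, Ideal.mem_comap, Submodule.mem_annihilator_span_singleton,
      Submodule.mem_annihilator_span_singleton, algebraMap_smul]
  rw [← hunder, ← IsLocalization.map_under S R' (R' ∙ y).annihilator, Ideal.map_le_iff_le_comap,
    IsLocalization.map_under S R' (R' ∙ y).annihilator, Ideal.under_def]

theorem localized'_supportedIn [IsNoetherianRing R] {Z : Set (PrimeSpectrum R)}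
    (hZ : IsUpperSet Z) :
    (supportedIn R M Z).localized' R' S f =
      supportedIn R' M' (PrimeSpectrum.comap (algebraMap R R') ⁻¹' Z) := by
  refine le_antisymm (((Submodule.localized'gi R' S f).gc _ _).mpr fun m hm q hq => hm ?_) ?_
  · refine le_trans (fun r hr => ?_)
      ((annihilator_span_singleton_le_iff_of_isLocalization (R := R) S).mp hq)
    rw [Submodule.mem_annihilator_span_singleton] at hr ⊢
    rw [← map_smul, hr, map_zero]
  · intro y hy
    obtain ⟨⟨m, s⟩, rfl⟩ := IsLocalizedModule.mk'_surjective S f y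
    have hm : f m ∈ supportedIn R' M' (PrimeSpectrum.comap (algebraMap R R') ⁻¹' Z) := by
      rw [← IsLocalizedModule.mk'_cancel' f m s]
      exact Submodule.smul_of_tower_mem _ s hy
    obtain ⟨u, hu⟩ := exists_annihilator_le_annihilator_smul S f m
    refine ⟨u • m, fun p hp => ?_, u * s, IsLocalizedModule.mk'_cancel_left f m u s⟩
    obtain ⟨p₀, hp₀, hp₀p⟩ := Ideal.exists_minimalPrimes_le (hu.trans hp)
    have hp₀' : ⟨p₀, hp₀.isPrime⟩ ∈ Set.range (PrimeSpectrum.comap (algebraMap R R')) := by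
      rw [PrimeSpectrum.localization_comap_range R' S]
      exact disjoint_of_mem_minimalPrimes_annihilator S f hp₀
    obtain ⟨q, hq⟩ := hp₀'
    refine hZ (show ⟨p₀, hp₀.isPrime⟩ ≤ p from hp₀p) (hq ▸ hm ?_)
    refine (annihilator_span_singleton_le_iff_of_isLocalization (R := R) S).mpr ?_
    exact hp₀.1.2.trans_eq (congrArg PrimeSpectrum.asIdeal hq).symm

end SupportedIn

section DimLT

variable {R : Type*} [CommRing R] {M : Type*} [AddCommGroup M] [Module R M]

variable (R M) in
/-- The largest submodule of `M` of dimension less than `n`; the dimension of a module is the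
supremum of `dim R/p = coheight p` over its support. -/
def dimLT (n : ℕ) : Submodule R M :=
  supportedIn R M {p | Order.coheight p < n}

theorem isUpperSet_coheight_lt {α : Type*} [Preorder α] (n : ℕ∞) :
    IsUpperSet {p : α | Order.coheight p < n} :=
  fun _ _ hab ha => (Order.coheight_anti hab).trans_lt ha

variable (R M) in
theorem supportDim_eq_iSup_coheight :
    Module.supportDim R M = ⨆ p ∈ Module.support R M, (Order.coheight p : WithBot ℕ∞) := by
  rw [Module.supportDim, Order.krullDim_eq_iSup_coheight, iSup_subtype]
  refine iSup_congr fun p => iSup_congr fun hp => ?_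
  rw [Order.coheight_eq_krullDim_Ici, Order.coheight_eq_krullDim_Ici]
  exact Order.krullDim_eq_of_orderIso
    { toFun := fun z => ⟨z.1.1, z.2⟩
      invFun := fun z => ⟨⟨z.1, Module.mem_support_mono z.2 hp⟩, z.2⟩
      left_inv := fun _ => rfl
      right_inv := fun _ => rfl
      map_rel_iff' := Iff.rfl }

theorem coheight_le_supportDim {p : PrimeSpectrum R} (hp : p ∈ Module.support R M) :
    (Order.coheight p : WithBot ℕ∞) ≤ Module.supportDim R M :=
  (le_iSup₂_of_le p hp le_rfl).trans_eq (supportDim_eq_iSup_coheight R M).symm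

theorem supportDim_lt_iff {n : ℕ} :
    Module.supportDim R M < n ↔ ∀ p ∈ Module.support R M, Order.coheight p < n := by
  constructor
  · intro h p hp
    exact WithBot.coe_lt_coe.mp ((coheight_le_supportDim hp).trans_lt h)
  · intro h
    rw [supportDim_eq_iSup_coheight]
    cases n with
    | zero =>
      have hempty (p) : p ∉ Module.support R M := fun hp => not_lt_zero (h p hp)
      simp [hempty]
    | succ n =>
      refine (iSup₂_le fun p hp => ?_).trans_lt
        (WithBot.coe_lt_coe.mpr (Nat.cast_lt.mpr n.lt_succ_self))
      exact WithBot.coe_le_coe.mpr (Order.le_of_lt_add_one (mod_cast h p hp))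

theorem le_dimLT_iff {N : Submodule R M} {n : ℕ} :
    N ≤ dimLT R M n ↔ Module.supportDim R N < n :=
  le_supportedIn_iff.trans supportDim_lt_iff.symm

theorem localized'_dimLT [IsNoetherianRing R] (hR : HasDimensionFormula R) {P : PrimeSpectrum R}
    {t : ℕ} (ht : Order.coheight P = t) {R' : Type*} [CommRing R'] [Algebra R R']
    [IsLocalization.AtPrime R' P.asIdeal] {M' : Type*} [AddCommGroup M'] [Module R M']
    [Module R' M'] [IsScalarTower R R' M'] (f : M →ₗ[R] M')
    [IsLocalizedModule P.asIdeal.primeCompl f] (n : ℕ) :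
    (dimLT R M (n + t)).localized' R' P.asIdeal.primeCompl f = dimLT R' M' n := by
  rw [dimLT, localized'_supportedIn _ _ (isUpperSet_coheight_lt _), dimLT]
  congr 1
  ext q
  rw [Set.mem_preimage, Set.mem_ofPred_eq, Set.mem_ofPred_eq, hR.coheight_comap P, ht, Nat.cast_add,
    ENat.add_lt_add_iff_right (ENat.natCast_ne_top t)]

end DimLT

section LocalizedQuotient

variable {R : Type*} [CommRing R] {M : Type*} [AddCommGroup M] [Module R M] (S : Submonoid R)
  (R' : Type*) [CommRing R'] [Algebra R R'] [IsLocalization S R'] {M' : Type*} [AddCommGroup M']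
  [Module R M'] [Module R' M'] [IsScalarTower R R' M'] (f : M →ₗ[R] M') [IsLocalizedModule S f]

theorem mk'_mem_localized'_iff (N : Submodule R M) {m : M} {s : S} :
    IsLocalizedModule.mk' f m s ∈ N.localized' R' S f ↔ ∃ u : S, u • m ∈ N := by
  constructor
  · rintro ⟨n, hn, t, h⟩
    obtain ⟨c, hc⟩ := (IsLocalizedModule.mk'_eq_mk'_iff f _ _ _ _).mp h.symm
    exact ⟨c * t, by rw [mul_smul, ← hc]; exact N.smul_of_tower_mem c (N.smul_of_tower_mem s hn)⟩
  · rintro ⟨u, hu⟩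
    exact ⟨u • m, hu, u * s, IsLocalizedModule.mk'_cancel_left f m u s⟩

theorem submoduleOf_localized' (N' N : Submodule R M) :
    (N'.localized' R' S f).submoduleOf (N.localized' R' S f) =
      (N'.submoduleOf N).localized' R' S (N.toLocalized' R' S f) := by
  ext y
  obtain ⟨⟨m, s⟩, rfl⟩ := IsLocalizedModule.mk'_surjective S (N.toLocalized' R' S f) y
  have coe_mk' : ((IsLocalizedModule.mk' (N.toLocalized' R' S f) m s : N.localized' R' S f) : M') =
      IsLocalizedModule.mk' f (m : M) s := by
    rw [eq_comm, IsLocalizedModule.mk'_eq_iff]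
    exact congrArg Subtype.val (IsLocalizedModule.mk'_cancel' (N.toLocalized' R' S f) m s).symm
  rw [Function.uncurry_apply_pair, mk'_mem_localized'_iff, Submodule.submoduleOf,
    Submodule.mem_comap, Submodule.subtype_apply, coe_mk', mk'_mem_localized'_iff]
  rfl

theorem exists_isLocalizedModule_quotient_submoduleOf (N' N : Submodule R M) :
    ∃ g : (N ⧸ N'.submoduleOf N) →ₗ[R]
      (N.localized' R' S f ⧸ (N'.localized' R' S f).submoduleOf (N.localized' R' S f)),
      IsLocalizedModule S g := by
  rw [submoduleOf_localized']
  exact ⟨_, IsLocalizedModule.toLocalizedQuotient' R' S (N.toLocalized' R' S f) (N'.submoduleOf N)⟩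

end LocalizedQuotient

section Filtration

variable {R : Type*} [CommRing R] {M : Type*} [AddCommGroup M] [Module R M]

theorem supportDim_mono {N N' : Submodule R M} (h : N ≤ N') :
    Module.supportDim R N ≤ Module.supportDim R N' :=
  Module.supportDim_le_of_injective (Submodule.inclusion h) (Submodule.inclusion_injective h)

theorem supportDim_submodule_le (N : Submodule R M) :
    Module.supportDim R N ≤ Module.supportDim R M :=
  Module.supportDim_le_of_injective N.subtype N.injective_subtype

theorem supportDim_eq_bot_iff {N : Submodule R M} : Module.supportDim R N = ⊥ ↔ N = ⊥ := by
  rw [Module.supportDim_eq_bot_iff_subsingleton, Submodule.subsingleton_iff_eq_bot]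

theorem lt_natCast_add_one_iff {e : WithBot ℕ∞} {n : ℕ} : e < (n + 1 : ℕ) ↔ e ≤ n := by
  induction e using WithBot.recBotCoe with
  | bot => exact iff_of_true (WithBot.bot_lt_coe _) bot_le
  | coe e =>
    have h : e < (n + 1 : ℕ) ↔ e ≤ n := by
      rw [Nat.cast_succ, ENat.lt_add_one_iff (ENat.natCast_ne_top n)]
    exact WithBot.coe_lt_coe.trans (h.trans WithBot.coe_le_coe.symm)

theorem exists_lt_natCast_of_ne_top {e : WithBot ℕ∞} (he : e ≠ ⊤) : ∃ n : ℕ, e < n := by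
  induction e using WithBot.recBotCoe with
  | bot => exact ⟨0, WithBot.bot_lt_coe _⟩
  | coe e =>
    obtain ⟨n, rfl⟩ := ENat.ne_top_iff_exists.mp fun h => he (congrArg WithBot.some h)
    exact ⟨n + 1, lt_natCast_add_one_iff.mpr le_rfl⟩

theorem isGreatest_dimLT_add_one (n : ℕ) :
    IsGreatest {N : Submodule R M | Module.supportDim R N ≤ n} (dimLT R M (n + 1)) :=
  ⟨lt_natCast_add_one_iff.mp (le_dimLT_iff.mp le_rfl),
    fun _ hN => le_dimLT_iff.mpr (lt_natCast_add_one_iff.mpr hN)⟩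

theorem dimLT_add_one_eq_of_notMem_dimSet {n : ℕ} (hn : (n : WithBot ℕ∞) ∉ dimSet R M) :
    dimLT R M (n + 1) = dimLT R M n := by
  refine eq_of_forall_le_iff fun N => ?_
  rw [le_dimLT_iff, le_dimLT_iff, lt_natCast_add_one_iff]
  refine ⟨fun h => lt_of_le_of_ne h fun heq => hn ⟨N, ?_, heq⟩, le_of_lt⟩
  rintro rfl
  rw [supportDim_eq_bot_iff.mpr rfl] at heq
  exact WithBot.bot_ne_coe heq

theorem exists_natCast_eq_of_mem_dimSet {d : ℕ} (hd : Module.supportDim R M < d)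
    {e : WithBot ℕ∞} (he : e ∈ dimSet R M) : ∃ n < d, e = (n : ℕ) := by
  obtain ⟨N, hN, rfl⟩ := he
  have hlt := (supportDim_submodule_le N).trans_lt hd
  obtain ⟨m, hm⟩ := WithBot.ne_bot_iff_exists.mp (mt supportDim_eq_bot_iff.mp hN)
  rw [← hm] at hlt ⊢
  have hmd : m < d := WithBot.coe_lt_coe.mp hlt
  obtain ⟨n, rfl⟩ := ENat.ne_top_iff_exists.mp hmd.ne_top
  exact ⟨n, Nat.cast_lt.mp hmd, rfl⟩

theorem finite_dimSet {d : ℕ} (hd : Module.supportDim R M < d) : (dimSet R M).Finite := by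
  refine ((Set.finite_Iio d).image ((↑) : ℕ → WithBot ℕ∞)).subset fun e he => ?_
  obtain ⟨n, hn, rfl⟩ := exists_natCast_eq_of_mem_dimSet hd he
  exact Set.mem_image_of_mem _ hn

theorem exists_isDimensionFiltration {d : ℕ} (hd : Module.supportDim R M < d) :
    ∃ (ℓ : ℕ) (D : Fin (ℓ + 1) → Submodule R M), IsDimensionFiltration R M ℓ D := by
  have hfin : (dimSet R M).Finite := finite_dimSet hd
  let e := hfin.toFinset.orderEmbOfFin rfl
  have hrange : Set.range e = dimSet R M := by
    rw [Finset.range_orderEmbOfFin, hfin.coe_toFinset]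
  have exists_natCast_eq (i) : ∃ n : ℕ, e i = n := by
    obtain ⟨n, -, hn⟩ := exists_natCast_eq_of_mem_dimSet hd (hrange ▸ Set.mem_range_self i)
    exact ⟨n, hn⟩
  choose n hn using exists_natCast_eq
  refine ⟨_, Fin.cases ⊥ fun i => dimLT R M (n i + 1), rfl, e, e.strictMono, hrange, fun i => ?_⟩
  rw [hn i]
  exact isGreatest_dimLT_add_one (n i)

theorem IsDimensionFiltration.exists_le_iff {ℓ : ℕ} {D : Fin (ℓ + 1) → Submodule R M}
    (h : IsDimensionFiltration R M ℓ D) :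
    ∃ d : Fin ℓ → WithBot ℕ∞, Set.range d = dimSet R M ∧ ∀ i N,
      (N ≤ D i.castSucc ↔ Module.supportDim R N < d i) ∧
        (N ≤ D i.succ ↔ Module.supportDim R N ≤ d i) := by
  obtain ⟨h0, d, hmono, hrange, hgreatest⟩ := h
  have le_succ_iff (i N) : N ≤ D i.succ ↔ Module.supportDim R N ≤ d i :=
    ⟨fun hN => (supportDim_mono hN).trans (hgreatest i).1, fun hN => (hgreatest i).2 hN⟩
  refine ⟨d, hrange, fun i N => ⟨?_, le_succ_iff i N⟩⟩
  by_cases hN : N = ⊥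
  · obtain ⟨N', hN', hdi⟩ : d i ∈ dimSet R M := hrange ▸ Set.mem_range_self i
    have hbot : d i ≠ ⊥ := hdi ▸ mt supportDim_eq_bot_iff.mp hN'
    exact iff_of_true (hN ▸ bot_le) (supportDim_eq_bot_iff.mpr hN ▸ bot_lt_iff_ne_bot.mpr hbot)
  · obtain ⟨l, hl⟩ : Module.supportDim R N ∈ Set.range d := hrange ▸ ⟨N, hN, rfl⟩
    rw [← hl, hmono.lt_iff_lt]
    rcases Fin.eq_zero_or_eq_succ i.castSucc with hi | ⟨j, hj⟩
    · rw [hi, h0, le_bot_iff]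
      have hival : (i : ℕ) = 0 := congrArg Fin.val hi
      exact iff_of_false hN (by lia)
    · rw [hj, le_succ_iff, ← hl, hmono.le_iff_le]
      have hival : (i : ℕ) = j + 1 := congrArg Fin.val hj
      lia

theorem IsDimensionFiltration.exists_eq_dimLT {ℓ : ℕ} {D : Fin (ℓ + 1) → Submodule R M}
    (h : IsDimensionFiltration R M ℓ D) :
    ∃ d : Fin ℓ → WithBot ℕ∞, Set.range d = dimSet R M ∧ ∀ (i) (n : ℕ), d i = n →
      D i.castSucc = dimLT R M n ∧ D i.succ = dimLT R M (n + 1) := by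
  obtain ⟨d, hrange, hle⟩ := h.exists_le_iff
  refine ⟨d, hrange, fun i n hn => ⟨?_, ?_⟩⟩ <;> refine eq_of_forall_le_iff fun N => ?_
  · rw [(hle i N).1, hn, le_dimLT_iff]
  · rw [(hle i N).2, hn, le_dimLT_iff, lt_natCast_add_one_iff]

theorem isCohenMacaulay_of_subsingleton [Subsingleton M] : IsCohenMacaulay R M := by
  intro P _ hP
  rw [Module.support_eq_empty] at hP
  exact absurd hP (Set.notMem_empty P)

theorem isSequentiallyCohenMacaulay_iff_dimLT (hM : Module.supportDim R M ≠ ⊤) :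
    IsSequentiallyCohenMacaulay R M ↔ ∀ n : ℕ, IsCohenMacaulay R
      (dimLT R M (n + 1) ⧸ (dimLT R M n).submoduleOf (dimLT R M (n + 1))) := by
  obtain ⟨d, hd⟩ := exists_lt_natCast_of_ne_top hM
  constructor
  · rintro ⟨ℓ, D, hD, hCM⟩ n
    obtain ⟨e, hrange, heq⟩ := hD.exists_eq_dimLT
    by_cases hn : (n : WithBot ℕ∞) ∈ dimSet R M
    · obtain ⟨i, hi⟩ : (n : WithBot ℕ∞) ∈ Set.range e := hrange ▸ hn
      rw [← (heq i n hi).1, ← (heq i n hi).2]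
      exact hCM i
    · rw [dimLT_add_one_eq_of_notMem_dimSet hn]
      have : Subsingleton (dimLT R M n ⧸ (dimLT R M n).submoduleOf (dimLT R M n)) := by
        rw [Submodule.Quotient.subsingleton_iff, Submodule.submoduleOf_self]
      exact isCohenMacaulay_of_subsingleton
  · intro hCM
    obtain ⟨ℓ, D, hD⟩ := exists_isDimensionFiltration hd
    obtain ⟨e, hrange, heq⟩ := hD.exists_eq_dimLT
    refine ⟨ℓ, D, hD, fun i => ?_⟩
    obtain ⟨n, -, hn⟩ := exists_natCast_eq_of_mem_dimSet hd (hrange ▸ Set.mem_range_self i)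
    rw [(heq i n hn).1, (heq i n hn).2]
    exact hCM n

end Filtration

open IsLocalRing PrimeSpectrum RingTheory.Sequence
open scoped Pointwise

section QuotSMulTop

variable {R : Type*} [CommRing R]

/-- `M / yM`, presented as the quotient by the ideal of the one-element list `[y]`, which is the
form in which regular sequences produce it. -/
def quotOfListSingletonEquiv (M : Type*) [AddCommGroup M] [Module R M] (y : R) :
    (M ⧸ (Ideal.ofList [y] • ⊤ : Submodule R M)) ≃ₗ[R] QuotSMulTop y M :=
  Submodule.quotEquivOfEq _ _ (by rw [Ideal.ofList_singleton, Submodule.ideal_span_singleton_smul])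

/-- The canonical isomorphism `(M / xM) / y(M / xM) ≃ (M / yM) / x(M / yM)`. -/
noncomputable def quotSMulTopComm (M : Type*) [AddCommGroup M] [Module R M] (x y : R) :
    QuotSMulTop y (QuotSMulTop x M) ≃ₗ[R] QuotSMulTop x (QuotSMulTop y M) :=
  (quotOfListSingletonEquiv (QuotSMulTop x M) y).symm ≪≫ₗ
    (Submodule.quotOfListConsSMulTopEquivQuotSMulTopInner M x [y]).symm ≪≫ₗ
    Submodule.quotOfListConsSMulTopEquivQuotSMulTopOuter M x [y] ≪≫ₗ
    QuotSMulTop.congr x (quotOfListSingletonEquiv M y)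

variable {M : Type*} [AddCommGroup M] [Module R M]

theorem eq_zero_of_smul_quotSMulTop_eq_zero {x y z : R} (hx : IsSMulRegular M x)
    (hy : IsSMulRegular M y) (hz : IsSMulRegular (QuotSMulTop y M) z) {u : QuotSMulTop x M}
    (hyu : y • u = 0) (hzu : z • u = 0) : u = 0 := by
  obtain ⟨u, rfl⟩ := Submodule.Quotient.mk_surjective _ u
  rw [← Submodule.Quotient.mk_smul, Submodule.Quotient.mk_eq_zero,
    Submodule.mem_smul_pointwise_iff_exists] at hyu hzu
  obtain ⟨v, -, hv⟩ := hyu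
  obtain ⟨w, -, hw⟩ := hzu
  have hzv : z • v = y • w := hx <| by
    change x • z • v = x • y • w
    rw [smul_comm x z, hv, smul_comm z y, ← hw, smul_comm y x]
  obtain ⟨v', -, rfl⟩ : v ∈ y • (⊤ : Submodule R M) :=
    mem_of_isSMulRegular_quotient_of_smul_mem hz
      (hzv ▸ Submodule.smul_mem_pointwise_smul _ _ _ Submodule.mem_top)
  have hu : x • v' = u := hy <| by
    change y • x • v' = y • u
    rw [← hv, smul_comm]; rfl
  rw [Submodule.Quotient.mk_eq_zero, ← hu]
  exact Submodule.smul_mem_pointwise_smul _ _ _ Submodule.mem_top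

theorem exists_isBaseChange_quotSMulTop {S N : Type*} [CommRing S] [Algebra R S]
    [AddCommGroup N] [Module R N] [Module S N] [IsScalarTower R S N] {f : M →ₗ[R] N}
    (hf : IsBaseChange S f) (x : R) :
    ∃ g : QuotSMulTop x M →ₗ[R] QuotSMulTop (algebraMap R S x) N, IsBaseChange S g := by
  have e := (QuotSMulTop.algebraMapTensorEquivTensorQuotSMulTop x M S).symm ≪≫ₗ
    QuotSMulTop.congr (algebraMap R S x) hf.equiv
  exact ⟨e.toLinearMap.restrictScalars R ∘ₗ TensorProduct.mk R S (QuotSMulTop x M) 1,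
    IsBaseChange.of_equiv e (fun _ ↦ by simp)⟩

end QuotSMulTop

section AssociatedPrimes

variable {R : Type*} [CommRing R] [IsNoetherianRing R] {M : Type*} [AddCommGroup M] [Module R M]

theorem exists_ne_zero_forall_smul_eq_zero {q : Ideal R} (hq : q ∈ associatedPrimes R M) :
    ∃ u : M, u ≠ 0 ∧ ∀ a ∈ q, a • u = 0 := by
  obtain ⟨hprime, u, hu⟩ := isAssociatedPrime_iff.mp hq
  have hmem (a : R) : a ∈ q ↔ a • u = 0 := by
    rw [hu, Submodule.mem_colon_singleton, Submodule.mem_bot]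
  refine ⟨u, ?_, fun a => (hmem a).mp⟩
  rintro rfl
  exact hprime.ne_top ((Ideal.eq_top_iff_one q).mpr ((hmem 1).mpr (smul_zero 1)))

theorem notMem_of_mem_associatedPrimes {x : R} (hx : IsSMulRegular M x) {q : Ideal R}
    (hq : q ∈ associatedPrimes R M) : x ∉ q := by
  obtain ⟨u, hu0, hu⟩ := exists_ne_zero_forall_smul_eq_zero hq
  exact fun hxq => hu0 (hx.right_eq_zero_of_smul (hu x hxq))

theorem exists_mem_isSMulRegular [Module.Finite R M] {I : Ideal R}
    (h : ∀ q ∈ associatedPrimes R M, ¬ I ≤ q) : ∃ x ∈ I, IsSMulRegular M x := by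
  by_contra! hI
  have hsub : (I : Set R) ⊆ ⋃ q ∈ associatedPrimes R M, (q : Set R) := by
    rw [biUnion_associatedPrimes_eq_compl_regular]
    exact hI
  obtain ⟨q, hq, hIq⟩ := (Ideal.subset_union_prime_finite (associatedPrimes.finite R M) ⊥ ⊥
    fun _ hq _ _ => IsAssociatedPrime.isPrime hq).mp hsub
  exact h q hq hIq

variable [IsLocalRing R] [Module.Finite R M]

theorem torsionBySet_eq_bot_of_le_smul_top {y : R} (hy : y ∈ maximalIdeal R)
    (hreg : IsSMulRegular M y) {s : Set R}
    (h : Submodule.torsionBySet R M s ≤ y • (⊤ : Submodule R M)) :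
    Submodule.torsionBySet R M s = ⊥ := by
  refine Submodule.eq_bot_of_le_smul_of_le_jacobson_bot (Ideal.span {y}) _
    (IsNoetherian.noetherian _) (fun u hu => ?_) ?_
  · obtain ⟨v, -, rfl⟩ := (Submodule.mem_smul_pointwise_iff_exists _ _ _).mp (h hu)
    rw [Submodule.ideal_span_singleton_smul]
    refine Submodule.smul_mem_pointwise_smul _ _ _ ?_
    rw [Submodule.mem_torsionBySet_iff] at hu ⊢
    refine fun a => hreg.right_eq_zero_of_smul ?_
    rw [smul_comm]
    exact hu a
  · rw [jacobson_eq_maximalIdeal _ bot_ne_top]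
    exact (Ideal.span_singleton_le_iff_mem _).mpr hy

theorem exists_le_mem_associatedPrimes_quotSMulTop {y : R} (hy : y ∈ maximalIdeal R)
    (hreg : IsSMulRegular M y) {q : Ideal R} (hq : q ∈ associatedPrimes R M) :
    ∃ q' ∈ associatedPrimes R (QuotSMulTop y M), q ≤ q' ∧ y ∈ q' := by
  obtain ⟨u₀, hu₀, hq⟩ := exists_ne_zero_forall_smul_eq_zero hq
  have hN : ¬ Submodule.torsionBySet R M q ≤ y • (⊤ : Submodule R M) := fun h => hu₀ <| by
    rw [← Submodule.mem_bot R, ← torsionBySet_eq_bot_of_le_smul_top hy hreg h,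
      Submodule.mem_torsionBySet_iff]
    exact fun a => hq a a.2
  obtain ⟨u, huN, hu⟩ := SetLike.not_le_iff_exists.mp hN
  have hu0 : (Submodule.Quotient.mk u : QuotSMulTop y M) ≠ 0 := by
    rwa [Ne, Submodule.Quotient.mk_eq_zero]
  obtain ⟨q', hq', hle⟩ := exists_le_isAssociatedPrime_of_isNoetherianRing R _ hu0
  have hmem {a : R} (ha : a • u ∈ y • (⊤ : Submodule R M)) : a ∈ q' := hle <| by
    rwa [Submodule.mem_colon_singleton, ← Submodule.Quotient.mk_smul, Submodule.mem_bot,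
      Submodule.Quotient.mk_eq_zero]
  refine ⟨q', hq', fun a ha => hmem ?_, hmem ?_⟩
  · rw [(Submodule.mem_torsionBySet_iff _ _).mp huN ⟨a, ha⟩]
    exact zero_mem _
  · exact Submodule.smul_mem_pointwise_smul _ _ _ Submodule.mem_top

end AssociatedPrimes

section LocalRing

variable {A : Type*} [CommRing A] [IsLocalRing A]

/-- `X` is Cohen-Macaulay of dimension `n` over the local ring `A`, for `X` finitely generated and
`A` Noetherian: `n` regular elements of the maximal ideal, taken one at a time, reduce `X` to a
module of dimension zero. -/
def IsCMOfDim (A : Type*) [CommRing A] [IsLocalRing A] :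
    ℕ → ∀ (X : Type*) [AddCommGroup X] [Module A X], Prop
  | 0, X, _, _ => Module.supportDim A X = 0
  | n + 1, X, _, _ => ∃ x ∈ maximalIdeal A, IsSMulRegular X x ∧ IsCMOfDim A n (QuotSMulTop x X)

variable {X : Type*} [AddCommGroup X] [Module A X]

theorem IsCMOfDim.of_equiv {n : ℕ} {Y : Type*} [AddCommGroup Y] [Module A Y] (e : X ≃ₗ[A] Y)
    (h : IsCMOfDim A n X) : IsCMOfDim A n Y := by
  induction n generalizing X Y with
  | zero => exact (Module.supportDim_eq_of_equiv e).symm.trans h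
  | succ n ih =>
    obtain ⟨x, hx, hreg, h⟩ := h
    exact ⟨x, hx, (e.isSMulRegular_congr x).mp hreg, ih (QuotSMulTop.congr x e) h⟩

theorem length_le_depth {rs : List A} (hrs : ∀ r ∈ rs, r ∈ maximalIdeal A)
    (h : IsRegular X rs) : (rs.length : ℕ∞) ≤ depth A X :=
  le_iSup₂ (f := fun (rs : List A) (_ : rs ∈ {rs : List A | (∀ r ∈ rs, r ∈ maximalIdeal A) ∧
    IsRegular X rs}) => (rs.length : ℕ∞)) rs ⟨hrs, h⟩

theorem exists_isRegular_length_eq_depth [Nontrivial X] (h : depth A X ≠ ⊤) :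
    ∃ rs : List A, (∀ r ∈ rs, r ∈ maximalIdeal A) ∧ IsRegular X rs ∧ rs.length = depth A X := by
  have hne : Nonempty {rs : List A | (∀ r ∈ rs, r ∈ maximalIdeal A) ∧ IsRegular X rs} :=
    ⟨[], List.forall_mem_nil _, IsRegular.nil A X⟩
  rw [depth, ← iSup_subtype''] at h ⊢
  obtain ⟨⟨rs, hrs, hreg⟩, hlen⟩ := ENat.exists_eq_iSup_of_lt_top h.lt_top
  exact ⟨rs, hrs, hreg, hlen⟩

variable [IsNoetherianRing A] [Module.Finite A X]

theorem isSMulRegular_quotSMulTop_of_swap {x y : A} (hx : x ∈ maximalIdeal A)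
    (hy : y ∈ maximalIdeal A) (hxX : IsSMulRegular X x)
    (hyX : IsSMulRegular (QuotSMulTop x X) y) : IsSMulRegular (QuotSMulTop y X) x := by
  have h : IsWeaklyRegular X [x, y] := by
    rw [isWeaklyRegular_cons_iff, isWeaklyRegular_singleton_iff]
    exact ⟨hxX, hyX⟩
  have hswap := isWeaklyRegular_of_perm_of_subset_maximalIdeal h (List.Perm.swap y x []) fun r hr =>
    by rcases List.mem_pair.mp hr with rfl | rfl <;> assumption
  rw [isWeaklyRegular_cons_iff, isWeaklyRegular_singleton_iff] at hswap
  exact hswap.2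

theorem exists_supportDim_quotSMulTop_eq {x : A} (hx : x ∈ maximalIdeal A)
    (hreg : IsSMulRegular X x) {n : ℕ} (hn : Module.supportDim A X = n) :
    ∃ k : ℕ, n = k + 1 ∧ Module.supportDim A (QuotSMulTop x X) = k := by
  have h := Module.supportDim_quotSMulTop_succ_eq_supportDim hreg hx
  rw [hn] at h
  generalize Module.supportDim A (QuotSMulTop x X) = e at h
  induction e with
  | bot => exact absurd h WithBot.bot_ne_coe
  | coe e =>
    have he : e + 1 = (n : ℕ∞) := by exact_mod_cast h
    lift e to ℕ using fun htop => ENat.natCast_ne_top n (by rw [← he, htop, top_add])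
    exact ⟨e, by exact_mod_cast he.symm, rfl⟩

theorem IsCMOfDim.supportDim_eq {n : ℕ} (h : IsCMOfDim A n X) : Module.supportDim A X = n := by
  induction n generalizing X with
  | zero => exact h
  | succ n ih =>
    obtain ⟨x, hx, hreg, h⟩ := h
    rw [← Module.supportDim_quotSMulTop_succ_eq_supportDim hreg hx, ih h]
    rfl

theorem IsCMOfDim.nontrivial {n : ℕ} (h : IsCMOfDim A n X) : Nontrivial X := by
  rw [← Module.supportDim_ne_bot_iff_nontrivial A, h.supportDim_eq]
  exact WithBot.coe_ne_bot

theorem IsCMOfDim.le_coheight {n : ℕ} (h : IsCMOfDim A n X) {q : PrimeSpectrum A}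
    (hq : q.asIdeal ∈ associatedPrimes A X) : n ≤ Order.coheight q := by
  induction n generalizing X q with
  | zero => exact zero_le
  | succ n ih =>
    obtain ⟨y, hy, hreg, h⟩ := h
    obtain ⟨q', hq', hle, hyq'⟩ := exists_le_mem_associatedPrimes_quotSMulTop hy hreg hq
    have hlt : q < ⟨q', hq'.isPrime⟩ := lt_of_le_of_ne hle fun heq =>
      notMem_of_mem_associatedPrimes hreg hq (heq ▸ hyq' : y ∈ q.asIdeal)
    rw [Nat.cast_add, Nat.cast_one]
    exact (add_le_add_left (ih h hq') 1).trans (Order.coheight_add_one_le hlt)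

theorem IsCMOfDim.eq_of_le_of_mem_associatedPrimes {n : ℕ} (h : IsCMOfDim A n X)
    {q p : PrimeSpectrum A} (hq : q.asIdeal ∈ associatedPrimes A X)
    (hp : p ∈ Module.support A X) (hle : p ≤ q) : p = q := by
  by_contra hne
  have hlt : (n : ℕ∞) + 1 ≤ Order.coheight p :=
    (add_le_add_left (h.le_coheight hq) 1).trans
      (Order.coheight_add_one_le (lt_of_le_of_ne hle hne))
  have hle : Order.coheight p ≤ (n : ℕ∞) := by
    have := coheight_le_supportDim hp
    rw [h.supportDim_eq] at this
    exact_mod_cast this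
  have : n + 1 ≤ n := by exact_mod_cast hlt.trans hle
  omega

/- Let `y` be a first element witnessing that `X` is Cohen-Macaulay. Prime avoidance provides a
`z` which is regular on both `X / xX` and `X / yX`; as `x, z` and `y, z` may be swapped, `X / zX`
links the two reductions. -/
theorem IsCMOfDim.quotSMulTop {n : ℕ} (h : IsCMOfDim A (n + 1) X) {x : A}
    (hx : x ∈ maximalIdeal A) (hreg : IsSMulRegular X x) : IsCMOfDim A n (QuotSMulTop x X) := by
  induction n generalizing X x with
  | zero =>
    obtain ⟨k, hk, hdim⟩ := exists_supportDim_quotSMulTop_eq hx hreg h.supportDim_eq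
    obtain rfl : 0 = k := Nat.succ_injective hk
    exact hdim
  | succ n ih =>
    obtain ⟨y, hy, hyreg, h⟩ := h
    obtain ⟨w, hw, hwreg, -⟩ := id h
    obtain ⟨z, hz, hzreg⟩ : ∃ z ∈ maximalIdeal A,
        IsSMulRegular (QuotSMulTop x X × QuotSMulTop y X) z := by
      refine exists_mem_isSMulRegular fun q hq hle => ?_
      rw [associatedPrimes.prod] at hq
      rcases hq with hq | hq
      · obtain ⟨u, hu, hqu⟩ := exists_ne_zero_forall_smul_eq_zero hq
        exact hu (eq_zero_of_smul_quotSMulTop_eq_zero hreg hyreg hwreg (hqu y (hle hy))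
          (hqu w (hle hw)))
      · exact notMem_of_mem_associatedPrimes hwreg hq (hle hw)
    have hzx : IsSMulRegular (QuotSMulTop x X) z :=
      hzreg.of_injective (LinearMap.inl A _ _) LinearMap.inl_injective
    have hzy : IsSMulRegular (QuotSMulTop y X) z :=
      hzreg.of_injective (LinearMap.inr A _ _) LinearMap.inr_injective
    have hX_z : IsCMOfDim A (n + 1) (QuotSMulTop z X) :=
      ⟨y, hy, isSMulRegular_quotSMulTop_of_swap hy hz hyreg hzy,
        (ih h hz hzy).of_equiv (quotSMulTopComm X y z)⟩
    exact ⟨z, hz, hzx, (ih hX_z hx (isSMulRegular_quotSMulTop_of_swap hx hz hreg hzx)).of_equiv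
      (quotSMulTopComm X z x)⟩

theorem isCMOfDim_length_of_isRegular {rs : List A} (h : IsRegular X rs)
    (hrs : ∀ r ∈ rs, r ∈ maximalIdeal A) (hdim : Module.supportDim A X = rs.length) :
    IsCMOfDim A rs.length X := by
  induction rs generalizing X with
  | nil => exact hdim
  | cons r rs ih =>
    obtain ⟨hr, hrs⟩ := List.forall_mem_cons.mp hrs
    obtain ⟨hreg, h⟩ := (isRegular_cons_iff _ _ _).mp h
    obtain ⟨k, hk, hdim⟩ := exists_supportDim_quotSMulTop_eq hr hreg hdim
    obtain rfl : rs.length = k := Nat.succ_injective hk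
    exact ⟨r, hr, hreg, ih h hrs hdim⟩

theorem IsCMOfDim.exists_isRegular {n : ℕ} (h : IsCMOfDim A n X) :
    ∃ rs : List A, (∀ r ∈ rs, r ∈ maximalIdeal A) ∧ IsRegular X rs ∧ rs.length = n := by
  induction n generalizing X with
  | zero =>
    have := h.nontrivial
    exact ⟨[], List.forall_mem_nil _, IsRegular.nil A X, rfl⟩
  | succ n ih =>
    obtain ⟨x, hx, hreg, h⟩ := h
    obtain ⟨rs, hrs, hregs, hlen⟩ := ih h
    exact ⟨x :: rs, List.forall_mem_cons.mpr ⟨hx, hrs⟩,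
      (isRegular_cons_iff _ _ _).mpr ⟨hreg, hregs⟩, congrArg (· + 1) hlen⟩

theorem length_le_supportDim {rs : List A} (h : IsRegular X rs) :
    ((rs.length : ℕ∞) : WithBot ℕ∞) ≤ Module.supportDim A X := by
  rw [← Module.supportDim_add_length_eq_supportDim_of_isRegular rs h]
  have := h.quot_ofList_smul_nontrivial (⊤ : Submodule A X)
  obtain ⟨e, he⟩ := WithBot.ne_bot_iff_exists.mp <| Module.supportDim_ne_bot_of_nontrivial A
    (X ⧸ Ideal.ofList rs • (⊤ : Submodule A X))
  rw [← he]
  exact_mod_cast le_add_self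

theorem depth_le_supportDim [Nontrivial X] : (depth A X : WithBot ℕ∞) ≤ Module.supportDim A X := by
  obtain ⟨e, he⟩ := WithBot.ne_bot_iff_exists.mp (Module.supportDim_ne_bot_of_nontrivial A X)
  rw [← he, WithBot.coe_le_coe]
  refine iSup₂_le fun rs hrs => ?_
  rw [← WithBot.coe_le_coe, he]
  exact length_le_supportDim hrs.2

theorem depth_eq_supportDim_iff [Nontrivial X] :
    (depth A X : WithBot ℕ∞) = Module.supportDim A X ↔ ∃ n, IsCMOfDim A n X := by
  constructor
  · intro h
    have hfin : Module.supportDim A X ≠ ⊤ :=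
      ne_top_of_le_ne_top ringKrullDim_ne_top (Module.supportDim_le_ringKrullDim A X)
    have hdepth : depth A X ≠ ⊤ := fun htop => hfin (by rw [← h, htop]; rfl)
    obtain ⟨rs, hrs, hreg, hlen⟩ := exists_isRegular_length_eq_depth hdepth
    exact ⟨_, isCMOfDim_length_of_isRegular hreg hrs (by rw [← h, ← hlen]; rfl)⟩
  · rintro ⟨n, h⟩
    obtain ⟨rs, hrs, hreg, rfl⟩ := h.exists_isRegular
    refine le_antisymm depth_le_supportDim ?_
    rw [h.supportDim_eq]
    exact WithBot.coe_le_coe.mpr (length_le_depth hrs hreg)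

end LocalRing

section Localization

theorem comap_mem_support_of_isBaseChange {R S M N : Type*} [CommRing R] [CommRing S] [Algebra R S]
    [AddCommGroup M] [Module R M] [Module.Finite R M] [AddCommGroup N] [Module R N] [Module S N]
    [IsScalarTower R S N] {f : M →ₗ[R] N} (hf : IsBaseChange S f) {q : PrimeSpectrum S}
    (hq : q ∈ Module.support S N) : comap (algebraMap R S) q ∈ Module.support R M := by
  rw [Module.mem_support_iff_of_finite]
  refine fun r hr => Module.annihilator_le_of_mem_support hq ?_
  rw [Module.mem_annihilator] at hr ⊢
  intro y
  induction y using hf.inductionOn with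
  | zero => exact smul_zero _
  | tmul x => rw [algebraMap_smul, ← map_smul, hr, map_zero]
  | smul s y ih => rw [smul_comm, ih, smul_zero]
  | add y₁ y₂ ih₁ ih₂ => rw [smul_add, ih₁, ih₂, add_zero]

section LocalRing

variable {A : Type*} [CommRing A] [IsLocalRing A] [IsNoetherianRing A] {X : Type*}
  [AddCommGroup X] [Module A X] [Module.Finite A X] {B : Type*} [CommRing B] [IsLocalRing B]
  [Algebra A B] {Y : Type*} [AddCommGroup Y] [Module A Y] [Module B Y] [IsScalarTower A B Y]
  [Nontrivial Y] {f : X →ₗ[A] Y}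

theorem IsCMOfDim.supportDim_localization_eq_zero {n : ℕ} (h : IsCMOfDim A n X)
    (p : Ideal A) [p.IsPrime] [IsLocalization.AtPrime B p] (hf : IsBaseChange B f)
    (hp : ∀ x ∈ p, ¬ IsSMulRegular X x) : Module.supportDim B Y = 0 := by
  obtain ⟨q, hq, hpq⟩ : ∃ q ∈ associatedPrimes A X, p ≤ q := by
    by_contra! hcon
    obtain ⟨x, hx, hreg⟩ := exists_mem_isSMulRegular hcon
    exact hp x hx hreg
  have comap_eq {q' : PrimeSpectrum B} (hq' : q' ∈ Module.support B Y) :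
      comap (algebraMap A B) q' = ⟨p, ‹_›⟩ := by
    have hle : comap (algebraMap A B) q' ≤ ⟨p, ‹_›⟩ :=
      (Ideal.comap_mono (le_maximalIdeal q'.isPrime.ne_top)).trans_eq
        (IsLocalization.AtPrime.under_maximalIdeal B p ‹_›)
    have heq := h.eq_of_le_of_mem_associatedPrimes (q := ⟨q, hq.isPrime⟩) hq
      (comap_mem_support_of_isBaseChange hf hq') (hle.trans hpq)
    exact le_antisymm hle (heq ▸ hpq)
  have : Subsingleton (Module.support B Y) := ⟨fun q₁ q₂ => Subtype.ext <|
    PrimeSpectrum.localization_comap_injective B p.primeCompl <|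
      (comap_eq q₁.2).trans (comap_eq q₂.2).symm⟩
  have : Nonempty (Module.support B Y) := (Module.nonempty_support_iff.mpr ‹_›).to_subtype
  exact Order.krullDim_eq_zero

theorem IsCMOfDim.localization {n : ℕ} (h : IsCMOfDim A n X) (p : Ideal A) [p.IsPrime]
    [IsLocalization.AtPrime B p] (hf : IsBaseChange B f) : ∃ k, IsCMOfDim B k Y := by
  have : IsNoetherianRing B := IsLocalization.isNoetherianRing p.primeCompl B ‹_›
  have : Module.Flat A B := IsLocalization.flat B p.primeCompl
  have hpA : p ≤ maximalIdeal A := le_maximalIdeal (Ideal.IsPrime.ne_top ‹_›)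
  induction n generalizing X Y with
  | zero =>
    refine ⟨0, h.supportDim_localization_eq_zero p hf fun x hx hreg => ?_⟩
    obtain ⟨k, hk, -⟩ := exists_supportDim_quotSMulTop_eq (hpA hx) hreg h.supportDim_eq
    exact Nat.succ_ne_zero k hk.symm
  | succ n ih =>
    by_cases! hp : ∀ x ∈ p, ¬ IsSMulRegular X x
    · exact ⟨0, h.supportDim_localization_eq_zero p hf hp⟩
    · obtain ⟨x, hx, hreg⟩ := hp
      have hxB : algebraMap A B x ∈ maximalIdeal B :=
        (IsLocalization.AtPrime.to_map_mem_maximal_iff B p x).mpr hx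
      have : Module.Finite B Y := Module.Finite.equiv hf.equiv
      have := nontrivial_quotSMulTop_of_mem_maximalIdeal Y hxB
      obtain ⟨g, hg⟩ := exists_isBaseChange_quotSMulTop hf x
      obtain ⟨k, hk⟩ := ih (h.quotSMulTop (hpA hx) hreg) hg
      exact ⟨k + 1, _, hxB, hreg.of_flat_of_isBaseChange hf, hk⟩

end LocalRing

variable {R : Type*} [CommRing R] {P m : Ideal R} [P.IsPrime] [m.IsPrime]
  {A : Type*} [CommRing A] [Algebra R A] [IsLocalization.AtPrime A m]
  {B : Type*} [CommRing B] [IsLocalRing B] [Algebra R B] [IsLocalization.AtPrime B P]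

theorem isLocalization_atPrime_under_maximalIdeal (hle : P ≤ m) [Algebra A B]
    [IsScalarTower R A B] : IsLocalization.AtPrime B ((maximalIdeal B).under A) := by
  have mem_iff (a : R) : algebraMap R A a ∈ (maximalIdeal B).under A ↔ a ∈ P := by
    rw [Ideal.mem_comap, ← IsScalarTower.algebraMap_apply,
      IsLocalization.AtPrime.to_map_mem_maximal_iff B P]
  have := IsLocalization.isLocalization_of_submonoid_le A B m.primeCompl P.primeCompl
    fun _ hx hxP => hx (hle hxP)
  refine IsLocalization.of_le_of_exists_dvd (P.primeCompl.map (algebraMap R A)) _ ?_ ?_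
  · rintro _ ⟨a, ha, rfl⟩ haP
    exact ha ((mem_iff a).mp haP)
  · intro x hx
    obtain ⟨a, s, rfl⟩ := IsLocalization.exists_mk'_eq m.primeCompl x
    refine ⟨algebraMap R A a, ⟨a, fun ha => hx ?_, rfl⟩, algebraMap R A s,
      (IsLocalization.mk'_spec A a s).symm⟩
    rw [IsLocalization.mk'_eq_mul_mk'_one]
    exact Ideal.mul_mem_right _ _ ((mem_iff a).mpr ha)

variable [IsNoetherianRing R] {M : Type*} [AddCommGroup M] [Module R M] [Module.Finite R M]

theorem IsCMOfDim.localization_of_le (hle : P ≤ m) [IsLocalRing A] {X : Type*} [AddCommGroup X]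
    [Module R X] [Module A X] [IsScalarTower R A X] (f : M →ₗ[R] X)
    [IsLocalizedModule m.primeCompl f] {Y : Type*} [AddCommGroup Y] [Module R Y] [Module B Y]
    [IsScalarTower R B Y] (g : M →ₗ[R] Y) [IsLocalizedModule P.primeCompl g] [Nontrivial Y]
    {n : ℕ} (h : IsCMOfDim A n X) : ∃ k, IsCMOfDim B k Y := by
  have hf : IsBaseChange A f := IsLocalizedModule.isBaseChange m.primeCompl A f
  have hg : IsBaseChange B g := IsLocalizedModule.isBaseChange P.primeCompl B g
  have : IsNoetherianRing A := IsLocalization.isNoetherianRing m.primeCompl A ‹_›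
  have : Module.Finite A X := Module.Finite.equiv hf.equiv
  have hcompl : m.primeCompl ≤ P.primeCompl := fun _ hx hxP => hx (hle hxP)
  let : Algebra A B :=
    IsLocalization.localizationAlgebraOfSubmonoidLe A B m.primeCompl P.primeCompl hcompl
  have : IsScalarTower R A B :=
    IsLocalization.localization_isScalarTower_of_submonoid_le A B m.primeCompl P.primeCompl hcompl
  let : Module A Y := Module.compHom Y (algebraMap A B)
  have : IsScalarTower A B Y := IsScalarTower.of_algebraMap_smul fun _ _ => rfl
  have : IsScalarTower R A Y := IsScalarTower.of_algebraMap_smul fun r y => by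
    rw [← algebraMap_smul B (algebraMap R A r) y, ← IsScalarTower.algebraMap_apply,
      algebraMap_smul]
  have : IsLocalization.AtPrime B ((maximalIdeal B).under A) :=
    isLocalization_atPrime_under_maximalIdeal (R := R) hle
  have hlift : (hf.lift g).restrictScalars R ∘ₗ f = g := LinearMap.ext (hf.lift_eq g)
  exact h.localization ((maximalIdeal B).under A) (IsBaseChange.of_comp hf (hlift.symm ▸ hg))

end Localization

section CohenMacaulay

variable {R : Type*} [CommRing R] [IsNoetherianRing R] {X : Type*} [AddCommGroup X] [Module R X]
  [Module.Finite R X]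

theorem depth_localizedModule_eq_supportDim_iff {P : PrimeSpectrum R}
    (hP : P ∈ Module.support R X) :
    (depth (Localization.AtPrime P.asIdeal) (LocalizedModule P.asIdeal.primeCompl X) :
        WithBot ℕ∞) =
      Module.supportDim (Localization.AtPrime P.asIdeal)
        (LocalizedModule P.asIdeal.primeCompl X) ↔
    ∃ n, IsCMOfDim (Localization.AtPrime P.asIdeal) n
      (LocalizedModule P.asIdeal.primeCompl X) := by
  have := Module.mem_support_iff.mp hP
  have : IsNoetherianRing (Localization.AtPrime P.asIdeal) :=
    IsLocalization.isNoetherianRing P.asIdeal.primeCompl _ ‹_›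
  have : Module.Finite (Localization.AtPrime P.asIdeal)
      (LocalizedModule P.asIdeal.primeCompl X) :=
    Module.Finite.of_isLocalizedModule P.asIdeal.primeCompl
      (LocalizedModule.mkLinearMap P.asIdeal.primeCompl X)
  exact depth_eq_supportDim_iff

theorem isCohenMacaulay_of_isCMOfDim [IsLocalRing R] {n : ℕ} (h : IsCMOfDim R n X) :
    IsCohenMacaulay R X := by
  intro P _ hP
  have := Module.mem_support_iff.mp hP
  exact (depth_localizedModule_eq_supportDim_iff hP).mpr <| h.localization P.asIdeal <|
    IsLocalizedModule.isBaseChange P.asIdeal.primeCompl _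
      (LocalizedModule.mkLinearMap P.asIdeal.primeCompl X)

section Prime

variable {B : Type*} [CommRing B] [IsLocalRing B] [Algebra R B] {Y : Type*} [AddCommGroup Y]
  [Module R Y] [Module B Y] [IsScalarTower R B Y]

theorem IsCohenMacaulay.exists_isCMOfDim [Nontrivial Y] (h : IsCohenMacaulay R X) (P : Ideal R)
    [P.IsPrime] [IsLocalization.AtPrime B P] (g : X →ₗ[R] Y) [IsLocalizedModule P.primeCompl g] :
    ∃ k, IsCMOfDim B k Y := by
  obtain ⟨m, hm, hle⟩ := P.exists_le_maximal (Ideal.IsPrime.ne_top ‹_›)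
  have hP : (⟨P, ‹_›⟩ : PrimeSpectrum R) ∈ Module.support R X :=
    Module.mem_support_iff.mpr (IsLocalizedModule.linearEquiv P.primeCompl
      (LocalizedModule.mkLinearMap P.primeCompl X) g).toEquiv.nontrivial
  have hm_mem : (⟨m, hm.isPrime⟩ : PrimeSpectrum R) ∈ Module.support R X :=
    Module.mem_support_mono hle hP
  obtain ⟨n, hn⟩ := (depth_localizedModule_eq_supportDim_iff hm_mem).mp (h _ hm hm_mem)
  exact hn.localization_of_le hle (LocalizedModule.mkLinearMap m.primeCompl X) g

theorem IsCohenMacaulay.of_isLocalizedModule (h : IsCohenMacaulay R X) (P : Ideal R) [P.IsPrime]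
    [IsLocalization.AtPrime B P] (g : X →ₗ[R] Y) [IsLocalizedModule P.primeCompl g] :
    IsCohenMacaulay B Y := by
  rcases subsingleton_or_nontrivial Y with _ | _
  · exact isCohenMacaulay_of_subsingleton
  have : IsNoetherianRing B := IsLocalization.isNoetherianRing P.primeCompl _ ‹_›
  have : Module.Finite B Y := Module.Finite.of_isLocalizedModule P.primeCompl g (Rₚ := B)
  obtain ⟨k, hk⟩ := h.exists_isCMOfDim P (B := B) g
  exact isCohenMacaulay_of_isCMOfDim hk

end Prime

theorem isCohenMacaulay_iff_exists_isCMOfDim [IsLocalRing R] [Nontrivial X] :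
    IsCohenMacaulay R X ↔ ∃ n, IsCMOfDim R n X := by
  refine ⟨fun h => ?_, fun ⟨n, h⟩ => isCohenMacaulay_of_isCMOfDim h⟩
  have : IsLocalization.AtPrime R (maximalIdeal R) :=
    IsLocalization.self fun x hx => not_not.mp fun hx' => hx ((mem_maximalIdeal x).mpr hx')
  have : IsLocalizedModule (maximalIdeal R).primeCompl (LinearMap.id : X →ₗ[R] X) :=
    isLocalizedModule_id (maximalIdeal R).primeCompl X R
  exact h.exists_isCMOfDim (maximalIdeal R) LinearMap.id

theorem depth_localizedModule_eq_supportDim_of_isCohenMacaulay {P : PrimeSpectrum R}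
    (hP : P ∈ Module.support R X) {Y : Type*} [AddCommGroup Y] [Module R Y]
    [Module (Localization.AtPrime P.asIdeal) Y] [IsScalarTower R (Localization.AtPrime P.asIdeal) Y]
    (g : X →ₗ[R] Y) [IsLocalizedModule P.asIdeal.primeCompl g]
    (h : IsCohenMacaulay (Localization.AtPrime P.asIdeal) Y) :
    (depth (Localization.AtPrime P.asIdeal) (LocalizedModule P.asIdeal.primeCompl X) :
        WithBot ℕ∞) =
      Module.supportDim (Localization.AtPrime P.asIdeal)
        (LocalizedModule P.asIdeal.primeCompl X) := by
  have : IsNoetherianRing (Localization.AtPrime P.asIdeal) :=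
    IsLocalization.isNoetherianRing P.asIdeal.primeCompl _ ‹_›
  have : Module.Finite (Localization.AtPrime P.asIdeal) Y :=
    Module.Finite.of_isLocalizedModule P.asIdeal.primeCompl g
  let e := (IsLocalizedModule.linearEquiv P.asIdeal.primeCompl g
    (LocalizedModule.mkLinearMap P.asIdeal.primeCompl X)).extendScalarsOfIsLocalization
      P.asIdeal.primeCompl (Localization.AtPrime P.asIdeal)
  have := Module.mem_support_iff.mp hP
  have : Nontrivial Y := e.toEquiv.nontrivial
  obtain ⟨n, hn⟩ := isCohenMacaulay_iff_exists_isCMOfDim.mp h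
  exact (depth_localizedModule_eq_supportDim_iff hP).mpr ⟨n, hn.of_equiv e⟩

end CohenMacaulay

section SequentiallyCohenMacaulay

variable {R : Type*} [CommRing R] {M : Type*} [AddCommGroup M] [Module R M]

theorem support_dimLT_quotient_subset (n : ℕ) :
    Module.support R (dimLT R M (n + 1) ⧸ (dimLT R M n).submoduleOf (dimLT R M (n + 1))) ⊆
      Module.support R M :=
  (Module.support_subset_of_surjective _ (Submodule.mkQ_surjective _)).trans
    (Module.support_subset_of_injective _ (Submodule.injective_subtype _))

variable [IsNoetherianRing R]

theorem exists_isLocalizedModule_dimLT_quotient (hR : HasDimensionFormula R)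
    {P : PrimeSpectrum R} {t : ℕ} (ht : Order.coheight P = t) {R' : Type*} [CommRing R']
    [Algebra R R'] [IsLocalization.AtPrime R' P.asIdeal] {M' : Type*} [AddCommGroup M']
    [Module R M'] [Module R' M'] [IsScalarTower R R' M'] (f : M →ₗ[R] M')
    [IsLocalizedModule P.asIdeal.primeCompl f] (n : ℕ) :
    ∃ g : (dimLT R M (n + t + 1) ⧸ (dimLT R M (n + t)).submoduleOf (dimLT R M (n + t + 1))) →ₗ[R]
        (dimLT R' M' (n + 1) ⧸ (dimLT R' M' n).submoduleOf (dimLT R' M' (n + 1))),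
      IsLocalizedModule P.asIdeal.primeCompl g := by
  have h := exists_isLocalizedModule_quotient_submoduleOf P.asIdeal.primeCompl R' f
    (dimLT R M (n + t)) (dimLT R M (n + 1 + t))
  rwa [localized'_dimLT hR ht, localized'_dimLT hR ht, Nat.add_right_comm n 1 t] at h

theorem isSequentiallyCohenMacaulay_localizedModule_iff (P : PrimeSpectrum R) :
    IsSequentiallyCohenMacaulay (Localization.AtPrime P.asIdeal)
        (LocalizedModule P.asIdeal.primeCompl M) ↔
      ∀ n : ℕ, IsCohenMacaulay (Localization.AtPrime P.asIdeal)
        (dimLT (Localization.AtPrime P.asIdeal) (LocalizedModule P.asIdeal.primeCompl M) (n + 1) ⧸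
          (dimLT (Localization.AtPrime P.asIdeal)
            (LocalizedModule P.asIdeal.primeCompl M) n).submoduleOf _) := by
  have : IsNoetherianRing (Localization.AtPrime P.asIdeal) :=
    IsLocalization.isNoetherianRing P.asIdeal.primeCompl _ ‹_›
  exact isSequentiallyCohenMacaulay_iff_dimLT
    (ne_top_of_le_ne_top ringKrullDim_ne_top (Module.supportDim_le_ringKrullDim _ _))

variable [Module.Finite R M]

theorem IsSequentiallyCohenMacaulay.localizedModule (hR : HasDimensionFormula R)
    (hM : Module.supportDim R M ≠ ⊤) (h : IsSequentiallyCohenMacaulay R M) {P : PrimeSpectrum R}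
    (hP : P ∈ Module.support R M) :
    IsSequentiallyCohenMacaulay (Localization.AtPrime P.asIdeal)
      (LocalizedModule P.asIdeal.primeCompl M) := by
  rw [isSequentiallyCohenMacaulay_iff_dimLT hM] at h
  rw [isSequentiallyCohenMacaulay_localizedModule_iff]
  intro n
  obtain ⟨t, ht⟩ := ENat.ne_top_iff_exists.mp fun htop : Order.coheight P = ⊤ =>
    hM (top_le_iff.mp ((congrArg WithBot.some htop).ge.trans (coheight_le_supportDim hP)))
  obtain ⟨g, _⟩ := exists_isLocalizedModule_dimLT_quotient hR ht.symm
    (R' := Localization.AtPrime P.asIdeal) (LocalizedModule.mkLinearMap P.asIdeal.primeCompl M) n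
  exact (h (n + t)).of_isLocalizedModule P.asIdeal g

theorem isSequentiallyCohenMacaulay_of_isMaximal (hR : HasDimensionFormula R)
    (hM : Module.supportDim R M ≠ ⊤)
    (h : ∀ P : PrimeSpectrum R, P.asIdeal.IsMaximal → P ∈ Module.support R M →
      IsSequentiallyCohenMacaulay (Localization.AtPrime P.asIdeal)
        (LocalizedModule P.asIdeal.primeCompl M)) :
    IsSequentiallyCohenMacaulay R M := by
  rw [isSequentiallyCohenMacaulay_iff_dimLT hM]
  intro n P hmax hP
  have ht : Order.coheight P = (0 : ℕ) :=
    Order.coheight_eq_zero.mpr (PrimeSpectrum.isMax_iff.mpr hmax)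
  obtain ⟨g, _⟩ := exists_isLocalizedModule_dimLT_quotient hR ht
    (R' := Localization.AtPrime P.asIdeal) (LocalizedModule.mkLinearMap P.asIdeal.primeCompl M) n
  have hPn := (isSequentiallyCohenMacaulay_localizedModule_iff P).mp
    (h P hmax (support_dimLT_quotient_subset n hP)) n
  exact depth_localizedModule_eq_supportDim_of_isCohenMacaulay hP g hPn

end SequentiallyCohenMacaulay

end SeqCM

theorem corollary2p1_general {R : Type*} [CommRing R] [IsNoetherianRing R]
    (hR : SeqCM.HasDimensionFormula R) {M : Type*} [AddCommGroup M] [Module R M]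
    [Module.Finite R M] (hM : Module.supportDim R M ≠ ⊤) :
    SeqCM.IsSequentiallyCohenMacaulay R M ↔
      ∀ P : PrimeSpectrum R, P ∈ Module.support R M →
        SeqCM.IsSequentiallyCohenMacaulay (Localization.AtPrime P.asIdeal)
          (LocalizedModule P.asIdeal.primeCompl M) :=
  ⟨fun h _ hP => h.localizedModule hR hM hP,
    fun h => SeqCM.isSequentiallyCohenMacaulay_of_isMaximal hR hM fun P _ hP => h P hP⟩

theorem corollary2p1 (k : Type*) [Field k] (R : Type*) [CommRing R] [Algebra k R]
    [Algebra.FiniteType k R] (M : Type*) [AddCommGroup M] [Module R M] [Module.Finite R M]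
    [Nontrivial M] :
    SeqCM.IsSequentiallyCohenMacaulay R M ↔
      ∀ P : PrimeSpectrum R, P ∈ Module.support R M →
        SeqCM.IsSequentiallyCohenMacaulay (Localization.AtPrime P.asIdeal)
          (LocalizedModule P.asIdeal.primeCompl M) :=
  have : IsNoetherianRing R := Algebra.FiniteType.isNoetherianRing k R
  corollary2p1_general (SeqCM.hasDimensionFormula_of_finiteType k R) <|
    ne_top_of_le_ne_top (SeqCM.ringKrullDim_ne_top_of_finiteType k R)
      (Module.supportDim_le_ringKrullDim R M)
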